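/- **Notation.** Let $p,q,a,b\in\mathbb C$ with $|p|<1$ and $a,b,q\neq 0$. For $x\ne 0$ put $\theta(x;p)=\prod_{j\ge 0}(1-p^jx)(1-p^{j+1}/x)$ and $\theta(x_1,\dots,x_\ell;p)=\prod_{i}\theta(x_i;p)$. For integers $z,k$ define the elliptic number and the elliptic weights $$[z]_{a,b;q,p}=\frac{\theta(q^z,aq^z,bq,aq/b;p)}{\theta(q,aq,bq^z,aq^z/b;p)},\qquad W_{a,b;q,p}(k)=\frac{\theta(aq^{2k+1},b,bq,a/b,aq/b;p)}{\theta(aq,bq^k,bq^{k+1},aq^k/b,aq^{k+1}/b;p)}\,q^k,$$ $$w_{a,b;q,p}(k)=\frac{\theta(aq^{2k+1},bq^{k-1},aq^{k-1}/b;p)}{\theta(aq^{2k-1},bq^{k+1},aq^{k+1}/b;p)}\,q .$$ Let $0\le b_1\le b_2\le\dots\le b_n$ be integers and let $B=B(b_1,\dots,b_n)=\{(i,j):1\le i\le n,\ 1\le j\le b_i\}$ be the corresponding Ferrers board, where $i$ numbers the columns from left to right and $j$ the rows from bottom to top. A placement of $k$ rooks on $B$ is a set $P\subseteq B$ of $k$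 cells, no two of them in the same row or column. A rook cancels all cells below it in its column and all cells to the right of it in its row. Let $U_B(P)$ be the set of cells of $B\setminus P$ not cancelled by any rook of $P$, and for a cell $(i,j)$ let $r_{(i,j)}(P)$ be the number of rooks $(i',j')\in P$ with $i'<i$ and $j'>j$. The elliptic rook numbers of Schlosser and Yoo are $$r_k(a,b;q,p;B)=\sum_{P}\ \prod_{(i,j)\in U_B(P)} w_{a,b;q,p}\bigl(i-j-r_{(i,j)}(P)\bigr),$$ the sum running over all placements $P$ of $k$ rooks on $B$. **Statement.** Let $N\ge 0$ be an integer with $b_i\le N$ for all $i$, and assume that the parameters are generic in the sense that $\theta(q^m;p)\ne0$ for $1\le m\le n$, that $\theta(aq^m;p)\neq 0$ for $-2N<m\le 2n+1$, and that $\theta(bq^m;p)\ne 0$ and $\theta(aq^m/b;p)\neq0$ for $-N\le m\le n+1$ ($m$ an integer). Then for all integers $0\le k\le n$ $$r_{n-k}(a,b;q,p;B)=\sum_{j=0}^{k}\frac{W_{a,b;q,p}(j)}{W_{a,b;q,p}(k)}\;\frac{\prod_{i=1}^{n}[\,j-i+b_i+1\,]_{aq^{2(i-1-b_i)},\,bq^{i-1-b_i};q,p}}{\prod_{i=0,\,i\ne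 j}^{k}[\,j-i\,]_{aq^{2i},\,bq^{i};q,p}} .$$ -/

import Mathlib

noncomputable section

namespace EllipticRook

/-- The modified Jacobi theta function
`θ(x; p) = ∏_{j ≥ 0} (1 - p ^ j * x) * (1 - p ^ (j + 1) / x)`, used for `x ≠ 0` and `‖p‖ < 1`
(the product then converges absolutely). -/
def theta (x p : ℂ) : ℂ :=
  ∏' j : ℕ, ((1 - p ^ j * x) * (1 - p ^ (j + 1) / x))

/-- The elliptic number `[z]_{a,b;q,p}` of an integer `z`. -/
def ellNumber (a b q p : ℂ) (z : ℤ) : ℂ :=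
  (theta (q ^ z) p * theta (a * q ^ z) p * theta (b * q) p * theta (a * q / b) p) /
    (theta q p * theta (a * q) p * theta (b * q ^ z) p * theta (a * q ^ z / b) p)

/-- The (large) elliptic weight `W_{a,b;q,p}(k)`. -/
def ellWeight (a b q p : ℂ) (k : ℤ) : ℂ :=
  (theta (a * q ^ (2 * k + 1)) p * theta b p * theta (b * q) p
      * theta (a / b) p * theta (a * q / b) p) /
    (theta (a * q) p * theta (b * q ^ k) p * theta (b * q ^ (k + 1)) p
      * theta (a * q ^ k / b) p * theta (a * q ^ (k + 1) / b) p) * q ^ k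

/-- The small elliptic weight `w_{a,b;q,p}(k)`, the weight of a single cell; it is the quotient
`W_{a,b;q,p}(k) / W_{a,b;q,p}(k - 1)` with the common theta factors cancelled. -/
def ellCellWeight (a b q p : ℂ) (k : ℤ) : ℂ :=
  (theta (a * q ^ (2 * k + 1)) p * theta (b * q ^ (k - 1)) p * theta (a * q ^ (k - 1) / b) p) /
    (theta (a * q ^ (2 * k - 1)) p * theta (b * q ^ (k + 1)) p
      * theta (a * q ^ (k + 1) / b) p) * q

/-- The board `B(b_1, …, b_n) = {(i, j) : 1 ≤ i ≤ n, 1 ≤ j ≤ b_i}`; `i` is the column (counted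
from the left) and `j` the row (counted from the bottom) of the cell `(i, j)`. -/
def ferrersBoard (n : ℕ) (b : ℕ → ℕ) : Finset (ℕ × ℕ) :=
  (Finset.Icc 1 n).biUnion fun i => (Finset.Icc 1 (b i)).image fun j => (i, j)

theorem mem_ferrersBoard (n : ℕ) (b : ℕ → ℕ) (c : ℕ × ℕ) :
    c ∈ ferrersBoard n b ↔ (1 ≤ c.1 ∧ c.1 ≤ n) ∧ (1 ≤ c.2 ∧ c.2 ≤ b c.1) := by
  obtain ⟨i, j⟩ := c
  simp only [ferrersBoard, Finset.mem_biUnion, Finset.mem_image, Finset.mem_Icc, Prod.mk.injEq]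
  constructor
  · rintro ⟨i', hi, j', hj, rfl, rfl⟩
    exact ⟨hi, hj⟩
  · rintro ⟨hi, hj⟩
    exact ⟨i, hi, j, hj, rfl, rfl⟩

/-- The placements of `k` non-attacking rooks on the board `B`: sets of `k` cells, no two of them
in the same column or in the same row. -/
def rookPlacements (B : Finset (ℕ × ℕ)) (k : ℕ) : Finset (Finset (ℕ × ℕ)) :=
  (B.powersetCard k).filter fun P => ∀ c ∈ P, ∀ d ∈ P, c ≠ d → c.1 ≠ d.1 ∧ c.2 ≠ d.2

/-- The cells of `B` without a rook of `P` that are not cancelled by a rook of `P`. A rook cancels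
the cells below it in its column and the cells to the right of it in its row. -/
def uncancelled (B P : Finset (ℕ × ℕ)) : Finset (ℕ × ℕ) :=
  (B \ P).filter fun c =>
    (∀ d ∈ P, ¬ (d.1 = c.1 ∧ c.2 < d.2)) ∧ (∀ d ∈ P, ¬ (d.2 = c.2 ∧ d.1 < c.1))

/-- The number of rooks of `P` strictly north-west of the cell `c`. -/
def northWest (P : Finset (ℕ × ℕ)) (c : ℕ × ℕ) : ℕ :=
  (P.filter fun d => d.1 < c.1 ∧ c.2 < d.2).card

/-- The elliptic weight of a rook placement `P` on `B`: the product of the cell weights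
`w_{a,b;q,p}(i - j - r)` over the uncancelled cells `(i, j)`, where `r` is the number of rooks
north-west of `(i, j)`. -/
def placementWeight (a b q p : ℂ) (B P : Finset (ℕ × ℕ)) : ℂ :=
  ∏ c ∈ uncancelled B P,
    ellCellWeight a b q p ((c.1 : ℤ) - (c.2 : ℤ) - (northWest P c : ℤ))

/-- The `k`-th elliptic rook number `r_k(a,b;q,p;B)` of a board `B`. -/
def ellRook (a b q p : ℂ) (B : Finset (ℕ × ℕ)) (k : ℕ) : ℂ :=
  ∑ P ∈ rookPlacements B k, placementWeight a b q p B P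

end EllipticRook

end

/-!
Write `W k` for the elliptic weight and `S z` for the elliptic number `[z]_{a,b;q,p}`. The elliptic
numbers of shifted bases are normalized differences of the single function `S`:
`[j - c]_{a q^{2c}, b q^c; q, p} = (S j - S c) / W c` (`IsGeneric.ellWeight_mul_ellNumber`). So the
right-hand side of the formula is, up to weights, the divided difference at the nodes
`S 0, …, S k` of the polynomial `∏ (X - S c_i) / W c_i` with `c_i = i - 1 - b_i`
(`weightedDivDiff`). Multiplication of the polynomial by a linear factor gives, by the Leibniz rule
for divided differences, a recursion in the number of columns (`weightedDivDiff_succ_succ`), which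
starts from the divided differences of a constant.

The rook numbers satisfy the same recursion. In a new last column, which is the highest one, the
free rows, counted from below, receive consecutive arguments in their cell weights, whatever the
rows occupied by the other rooks are (`image_rowLabel`): the number of rooks to the north-west
makes up for the occupied rows. Hence an empty last column contributes a telescoping product of cell
weights, which is a quotient of two values of `W`, and a rook there contributes a sum of such
quotients, which is a difference of values of `S` by `S (z + 1) = S z + W z`
(`ellRook_succ_succ`, `IsGeneric.prod_ellCellWeight`, `IsGeneric.sum_prod_ellCellWeight`).

The formula for shifted elliptic numbers is an instance of the three-term relation of theta
functions (`theta_three_term`). Jacobi's triple product identity, the limit of a finite identity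
that is proved by induction, makes `θ` a multiple of the series `∑ (-1)^n p^{n(n-1)/2} x^n`
(`exists_theta_eq_mul_thetaSeries`). The double series for `θ(xy) θ(x/y) / x`, split by parity, is a
`2 × 2` minor in `x` and `y` (`thetaSeries_mul_thetaSeries`), and the three-term relation is the
Plücker relation among such minors.
-/

namespace EllipticRook

open Filter Topology

/-! ### Jacobi's triple product identity -/

/-- The triangular number `n * (n - 1) / 2` of an integer `n`, as a natural number. -/
def triExp (n : ℤ) : ℕ := (n * (n - 1) / 2).toNat

theorem two_mul_triExp (n : ℤ) : 2 * (triExp n : ℤ) = n * (n - 1) := by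
  have h2 : 2 ∣ n * (n - 1) := (Int.even_mul_pred_self n).two_dvd
  have h0 : 0 ≤ n * (n - 1) := by
    rcases le_or_gt n 0 with h | h
    · nlinarith
    · exact mul_nonneg h.le (by omega)
  unfold triExp
  omega

theorem summable_pow_choose_two_mul_pow {r : ℝ} (hr0 : 0 ≤ r) (hr : r < 1) {R : ℝ} (hR : 0 ≤ R) :
    Summable fun k : ℕ => r ^ k.choose 2 * R ^ k := by
  have hlim : Tendsto (fun k : ℕ => r ^ k * R) atTop (𝓝 0) := by
    simpa using (tendsto_pow_atTop_nhds_zero_of_lt_one hr0 hr).mul_const R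
  refine summable_of_ratio_norm_eventually_le (r := 1 / 2) (by norm_num) ?_
  filter_upwards [hlim.eventually_le_const (show (0 : ℝ) < 1 / 2 by norm_num)] with k hk
  rw [Real.norm_of_nonneg (by positivity), Real.norm_of_nonneg (by positivity)]
  have : r ^ (k + 1).choose 2 * R ^ (k + 1) = (r ^ k * R) * (r ^ k.choose 2 * R ^ k) := by
    rw [Nat.choose_succ_succ' k 1, Nat.choose_one_right]
    ring
  rw [this]
  exact mul_le_mul_of_nonneg_right hk (by positivity)

/-- Absolute convergence of a bilateral series with quadratically growing exponents. The exponents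
are natural numbers, so that `p = 0` is included. -/
theorem summable_norm_pow_mul_zpow {p x : ℂ} (hp : ‖p‖ < 1) (hx : x ≠ 0) (e : ℤ → ℕ)
    (he : ∀ n : ℤ, |n| * (|n| - 1) ≤ 2 * e n) :
    Summable fun n : ℤ => ‖p ^ e n * x ^ n‖ := by
  set R : ℝ := max ‖x‖ ‖x‖⁻¹ with hRdef
  have hR0 : 0 ≤ R := le_max_of_le_left (norm_nonneg x)
  have hbase := summable_pow_choose_two_mul_pow (norm_nonneg p) hp hR0
  have hint : Summable fun n : ℤ => ‖p‖ ^ n.natAbs.choose 2 * R ^ n.natAbs := by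
    refine Summable.of_nat_of_neg ?_ ?_ <;> simpa using hbase
  refine Summable.of_nonneg_of_le (fun _ => norm_nonneg _) (fun n => ?_) hint
  rw [norm_mul, norm_pow, norm_zpow]
  refine mul_le_mul ?_ ?_ (by positivity) (by positivity)
  · refine pow_le_pow_of_le_one (norm_nonneg p) hp.le ?_
    have h1 := he n
    rw [Nat.choose_two_right]
    refine Nat.div_le_of_le_mul ?_
    rcases Nat.eq_zero_or_pos n.natAbs with h0 | h0
    · simp [h0]
    · zify [h0]
      simpa using h1
  · rcases Int.natAbs_eq n with h | h
    · rw [h, zpow_natCast, Int.natAbs_natCast]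
      exact pow_le_pow_left₀ (norm_nonneg x) (le_max_left _ _) _
    · rw [h, zpow_neg, zpow_natCast, Int.natAbs_neg, Int.natAbs_natCast, ← inv_pow]
      exact pow_le_pow_left₀ (by positivity) (le_max_right _ _) _

theorem abs_mul_pred_le_triExp (n : ℤ) : |n| * (|n| - 1) ≤ 2 * triExp n := by
  rw [two_mul_triExp]
  have h1 := abs_mul_abs_self n
  have h2 := le_abs_self n
  nlinarith

/-- The `q`-factorial `(p; p)_k`. -/
def qFact (p : ℂ) (k : ℕ) : ℂ := ∏ i ∈ Finset.range k, (1 - p ^ (i + 1))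

/-- The reciprocal of `(p; p)_i` for an integer `i`; it is `0` for `i < 0`. -/
noncomputable def qFactInv (p : ℂ) (i : ℤ) : ℂ := if i < 0 then 0 else (qFact p i.toNat)⁻¹

theorem one_sub_pow_succ_ne_zero {p : ℂ} (hp : ‖p‖ < 1) (i : ℕ) : 1 - p ^ (i + 1) ≠ 0 := by
  intro h
  have h1 : ‖p ^ (i + 1)‖ = 1 := by rw [← sub_eq_zero.mp h, norm_one]
  rw [norm_pow] at h1
  exact absurd h1 (pow_lt_one₀ (norm_nonneg p) hp (by omega)).ne

theorem qFactInv_sub_one {p : ℂ} (hp : ‖p‖ < 1) (i : ℕ) :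
    qFactInv p ((i : ℤ) - 1) = (1 - p ^ i) * qFactInv p i := by
  rcases i with _ | i
  · simp [qFactInv]
  · have h1 : ¬ (((i + 1 : ℕ) : ℤ) - 1 < 0) := by omega
    have h2 : ¬ (((i + 1 : ℕ) : ℤ) < 0) := by omega
    have h3 : (((i + 1 : ℕ) : ℤ) - 1).toNat = i := by omega
    rw [qFactInv, qFactInv, if_neg h1, if_neg h2, h3, Int.toNat_natCast, qFact, qFact,
      Finset.prod_range_succ, mul_inv, mul_left_comm, mul_inv_cancel₀
        (one_sub_pow_succ_ne_zero hp i), mul_one]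

/-- The coefficient of `(-x) ^ n` in `∏_{j < m} (1 - p ^ j * x) * (1 - p ^ (j + 1) / x)`. -/
noncomputable def tripleCoeff (p : ℂ) (m : ℕ) (n : ℤ) : ℂ :=
  p ^ triExp n * (qFact p (2 * m) * qFactInv p (m - n) * qFactInv p (m + n))

/-- The recursion that corresponds to multiplication by
`(1 - p ^ m * x) * (1 - p ^ (m + 1) / x) = 1 + p ^ (2 * m + 1) - p ^ m * x - p ^ (m + 1) / x`. -/
theorem tripleCoeff_succ {p : ℂ} (hp : ‖p‖ < 1) (m : ℕ) (n : ℤ) :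
    tripleCoeff p (m + 1) n = (1 + p ^ (2 * m + 1)) * tripleCoeff p m n
      + p ^ m * tripleCoeff p m (n - 1) + p ^ (m + 1) * tripleCoeff p m (n + 1) := by
  by_cases hA : (m : ℤ) + 1 - n < 0
  · have z : ∀ i : ℤ, i < 0 → qFactInv p i = 0 := fun i hi => if_pos hi
    simp only [tripleCoeff, Nat.cast_add, Nat.cast_one]
    rw [z _ hA, z _ (show (m : ℤ) - n < 0 by omega), z _ (show (m : ℤ) - (n - 1) < 0 by omega),
      z _ (show (m : ℤ) - (n + 1) < 0 by omega)]
    ring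
  by_cases hB : (m : ℤ) + 1 + n < 0
  · have z : ∀ i : ℤ, i < 0 → qFactInv p i = 0 := fun i hi => if_pos hi
    simp only [tripleCoeff, Nat.cast_add, Nat.cast_one]
    rw [z _ hB, z _ (show (m : ℤ) + n < 0 by omega), z _ (show (m : ℤ) + (n - 1) < 0 by omega),
      z _ (show (m : ℤ) + (n + 1) < 0 by omega)]
    ring
  obtain ⟨A, hA'⟩ := Int.eq_ofNat_of_zero_le (not_lt.mp hA)
  obtain ⟨B, hB'⟩ := Int.eq_ofNat_of_zero_le (not_lt.mp hB)
  have hT := two_mul_triExp n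
  have hT1 := two_mul_triExp (n - 1)
  have hT2 := two_mul_triExp (n + 1)
  have e1 : m + triExp (n - 1) = triExp n + A := by zify; nlinarith
  have e2 : m + 1 + triExp (n + 1) = triExp n + B := by zify; nlinarith
  have hAB : A + B = 2 * m + 2 := by zify; linarith
  have hQ : qFact p (2 * (m + 1)) =
      qFact p (2 * m) * (1 - p ^ (2 * m + 1)) * (1 - p ^ (A + B)) := by
    rw [hAB, qFact, qFact, show 2 * (m + 1) = 2 * m + 1 + 1 by ring, Finset.prod_range_succ,
      Finset.prod_range_succ]
  have rA := qFactInv_sub_one hp A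
  have rB := qFactInv_sub_one hp B
  -- the step from `A - 1` to `A - 2`, multiplied by `p ^ B` so that it stays valid at `A = 0`
  have rA2 : p ^ B * qFactInv p ((A : ℤ) - 2) = (p ^ B - p ^ (2 * m + 1)) * qFactInv p (A - 1) := by
    rcases A with _ | A
    · simp [qFactInv]
    · have := qFactInv_sub_one hp A
      rw [show ((A + 1 : ℕ) : ℤ) - 2 = A - 1 by push_cast; ring, this,
        show 2 * m + 1 = A + B by omega, show ((A + 1 : ℕ) : ℤ) - 1 = A by push_cast; ring]
      ring
  have rB2 : p ^ A * qFactInv p ((B : ℤ) - 2) = (p ^ A - p ^ (2 * m + 1)) * qFactInv p (B - 1) := by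
    rcases B with _ | B
    · simp [qFactInv]
    · have := qFactInv_sub_one hp B
      rw [show ((B + 1 : ℕ) : ℤ) - 2 = B - 1 by push_cast; ring, this,
        show 2 * m + 1 = A + B by omega, show ((B + 1 : ℕ) : ℤ) - 1 = B by push_cast; ring]
      ring
  have f1 : p ^ m * p ^ triExp (n - 1) = p ^ triExp n * p ^ A := by rw [← pow_add, e1, pow_add]
  have f2 : p ^ (m + 1) * p ^ triExp (n + 1) = p ^ triExp n * p ^ B := by
    rw [← pow_add, e2, pow_add]
  simp only [tripleCoeff, Nat.cast_add, Nat.cast_one, hQ]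
  rw [show (m : ℤ) + 1 - n = A by omega, show (m : ℤ) + 1 + n = B by omega,
    show (m : ℤ) - n = A - 1 by omega, show (m : ℤ) + n = B - 1 by omega,
    show (m : ℤ) - (n - 1) = A by omega, show (m : ℤ) + (n - 1) = B - 2 by omega,
    show (m : ℤ) - (n + 1) = A - 2 by omega, show (m : ℤ) + (n + 1) = B by omega]
  rw [← mul_assoc (p ^ m), f1, ← mul_assoc (p ^ (m + 1)), f2]
  calc _ = p ^ triExp n * qFact p (2 * m) * qFactInv p A * qFactInv p B *
        ((1 - p ^ (2 * m + 1)) * (1 - p ^ (A + B))) := by ring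
    _ = p ^ triExp n * qFact p (2 * m) * ((1 + p ^ (2 * m + 1)) * (qFactInv p (A - 1)
          * qFactInv p (B - 1)) + qFactInv p A * ((p ^ A - p ^ (2 * m + 1)) * qFactInv p (B - 1))
          + qFactInv p B * ((p ^ B - p ^ (2 * m + 1)) * qFactInv p (A - 1))) := by
        rw [rA, rB]
        ring
    _ = _ := by rw [← rA2, ← rB2]; ring

/-- The finite form of Jacobi's triple product identity. -/
theorem hasSum_tripleCoeff {p x : ℂ} (hp : ‖p‖ < 1) (hx : x ≠ 0) (m : ℕ) :
    HasSum (fun n : ℤ => tripleCoeff p m n * (-x) ^ n)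
      (∏ j ∈ Finset.range m, ((1 - p ^ j * x) * (1 - p ^ (j + 1) / x))) := by
  have hx' : -x ≠ 0 := neg_ne_zero.mpr hx
  induction m with
  | zero =>
    rw [Finset.prod_range_zero]
    convert hasSum_single (f := fun n : ℤ => tripleCoeff p 0 n * (-x) ^ n) 0 ?_ using 1
    · simp [tripleCoeff, triExp, qFact, qFactInv]
    · intro n hn
      rcases lt_or_gt_of_ne hn with h | h
      · have : ((0 : ℕ) : ℤ) + n < 0 := by simpa using h
        simp [tripleCoeff, qFactInv, h]
      · simp [tripleCoeff, qFactInv, h]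
  | succ m ih =>
    have s1 := (Equiv.subRight (1 : ℤ)).hasSum_iff.mpr ih
    have s2 := (Equiv.addRight (1 : ℤ)).hasSum_iff.mpr ih
    simp only [Function.comp_def, Equiv.subRight_apply] at s1
    simp only [Function.comp_def, Equiv.coe_addRight] at s2
    have := ((ih.mul_left (1 + p ^ (2 * m + 1))).add (s1.mul_left (p ^ m * (-x)))).add
      (s2.mul_left (p ^ (m + 1) * (-x)⁻¹))
    have hP : ∀ P : ℂ, (1 + p ^ (2 * m + 1)) * P + p ^ m * -x * P + p ^ (m + 1) * (-x)⁻¹ * P =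
        P * ((1 - p ^ m * x) * (1 - p ^ (m + 1) / x)) := fun P => by
      field_simp
      ring
    rw [hP, ← Finset.prod_range_succ] at this
    refine Eq.subst (motive := fun f : ℤ → ℂ => HasSum f _) (funext fun n => ?_) this
    rw [tripleCoeff_succ hp, zpow_sub_one₀ hx', zpow_add_one₀ hx']
    field_simp

theorem multipliable_one_sub_pow_mul {p : ℂ} (hp : ‖p‖ < 1) (x : ℂ) :
    Multipliable fun j : ℕ => 1 - p ^ j * x := by
  have := multipliable_one_add_of_summable (f := fun j : ℕ => -(p ^ j * x)) (by
    simp only [norm_neg, norm_mul, norm_pow]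
    exact (summable_geometric_of_lt_one (norm_nonneg p) hp).mul_right _)
  simpa [sub_eq_add_neg] using this

theorem tendsto_prod_theta {p x : ℂ} (hp : ‖p‖ < 1) :
    Tendsto (fun m => ∏ j ∈ Finset.range m, ((1 - p ^ j * x) * (1 - p ^ (j + 1) / x))) atTop
      (𝓝 (theta x p)) := by
  refine Multipliable.tendsto_prod_tprod_nat ?_
  refine (multipliable_one_sub_pow_mul hp x).mul ?_
  convert multipliable_one_sub_pow_mul hp (p / x) using 2
  ring

theorem exists_tendsto_qFact {p : ℂ} (hp : ‖p‖ < 1) :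
    ∃ Q : ℂ, Q ≠ 0 ∧ Tendsto (qFact p) atTop (𝓝 Q) := by
  have hs : Summable fun i : ℕ => ‖-p ^ (i + 1)‖ := by
    simp only [norm_neg, norm_pow, pow_succ, norm_mul]
    exact (summable_geometric_of_lt_one (norm_nonneg p) hp).mul_right _
  refine ⟨∏' i : ℕ, (1 + -p ^ (i + 1)), tprod_one_add_ne_zero_of_summable (fun i => ?_) hs, ?_⟩
  · rw [← sub_eq_add_neg]
    exact one_sub_pow_succ_ne_zero hp i
  · have := (multipliable_one_add_of_summable hs).tendsto_prod_tprod_nat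
    simp only [← sub_eq_add_neg] at this ⊢
    exact this

/-- The bilateral series `∑ (-1) ^ n p ^ (n (n - 1) / 2) x ^ n`. -/
noncomputable def thetaSeries (x p : ℂ) : ℂ := ∑' n : ℤ, p ^ triExp n * (-x) ^ n

/-- Jacobi's triple product identity, with an unspecified constant: only homogeneous relations
among theta functions are derived from it. -/
theorem exists_theta_eq_mul_thetaSeries {p : ℂ} (hp : ‖p‖ < 1) :
    ∃ K : ℂ, ∀ x : ℂ, x ≠ 0 → theta x p = K * thetaSeries x p := by
  obtain ⟨Q, hQ, hlim⟩ := exists_tendsto_qFact hp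
  -- the limit of `(p; p)_{2m} / ((p; p)_{m-n} (p; p)_{m+n})`, the same for every `n`
  refine ⟨Q * Q⁻¹ * Q⁻¹, fun x hx => ?_⟩
  have hlimInv : Tendsto (fun k => (qFact p k)⁻¹) atTop (𝓝 Q⁻¹) := hlim.inv₀ hQ
  have htoNat : ∀ n : ℤ, Tendsto (fun m : ℕ => ((m : ℤ) + n).toNat) atTop atTop := fun n =>
    tendsto_atTop.mpr fun b => by
      filter_upwards [eventually_ge_atTop (b + n.natAbs)] with m hm
      omega
  have hInv : ∀ n : ℤ, Tendsto (fun m : ℕ => qFactInv p ((m : ℤ) + n)) atTop (𝓝 Q⁻¹) := fun n => by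
    refine (hlimInv.comp (htoNat n)).congr' ?_
    filter_upwards [eventually_ge_atTop n.natAbs] with m hm
    rw [qFactInv, if_neg (by omega)]
    rfl
  have hmul : Tendsto (fun m : ℕ => 2 * m) atTop atTop :=
    tendsto_id.const_mul_atTop' (by norm_num)
  obtain ⟨C, hC⟩ := hlim.norm.bddAbove_range
  obtain ⟨D, hD⟩ := hlimInv.norm.bddAbove_range
  replace hC : ∀ k, ‖qFact p k‖ ≤ C := fun k => hC ⟨k, rfl⟩
  replace hD : ∀ k, ‖(qFact p k)⁻¹‖ ≤ D := fun k => hD ⟨k, rfl⟩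
  have hC0 : 0 ≤ C := (norm_nonneg _).trans (hC 0)
  have hD0 : 0 ≤ D := (norm_nonneg _).trans (hD 0)
  have hD' : ∀ i, ‖qFactInv p i‖ ≤ D := fun i => by
    rw [qFactInv]
    split_ifs
    · simpa using hD0
    · exact hD _
  have hsum := summable_norm_pow_mul_zpow hp (neg_ne_zero.mpr hx) triExp abs_mul_pred_le_triExp
  have key : Tendsto (fun m : ℕ => ∑' n : ℤ, tripleCoeff p m n * (-x) ^ n) atTop
      (𝓝 (∑' n : ℤ, p ^ triExp n * (Q * Q⁻¹ * Q⁻¹) * (-x) ^ n)) := by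
    refine tendsto_tsum_of_dominated_convergence
      (bound := fun n : ℤ => C * D * D * ‖p ^ triExp n * (-x) ^ n‖) (hsum.mul_left _) ?_ ?_
    · intro n
      refine Tendsto.mul_const _ (Tendsto.const_mul _ ?_)
      have h1 := hInv (-n)
      simp only [← sub_eq_add_neg] at h1
      exact ((hlim.comp hmul).mul h1).mul (hInv n)
    · refine Eventually.of_forall fun m n => ?_
      rw [tripleCoeff, mul_right_comm, norm_mul, mul_comm]
      refine mul_le_mul_of_nonneg_right ?_ (norm_nonneg _)
      rw [norm_mul, norm_mul]
      exact mul_le_mul (mul_le_mul (hC _) (hD' _) (norm_nonneg _) hC0) (hD' _) (norm_nonneg _)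
        (mul_nonneg hC0 hD0)
  simp only [(hasSum_tripleCoeff hp hx _).tsum_eq] at key
  rw [tendsto_nhds_unique (tendsto_prod_theta hp) key, thetaSeries, ← tsum_mul_left]
  exact tsum_congr fun n => by ring

theorem thetaSeries_inv (p : ℂ) {x : ℂ} (hx : x ≠ 0) :
    thetaSeries x⁻¹ p = -(thetaSeries x p / x) := by
  have hx' : -x ≠ 0 := neg_ne_zero.mpr hx
  rw [thetaSeries, thetaSeries, ← (Equiv.subLeft (1 : ℤ)).tsum_eq, ← neg_div, div_eq_mul_inv,
    ← tsum_neg, ← tsum_mul_right]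
  refine tsum_congr fun n => ?_
  have hT : triExp (1 - n) = triExp n := by
    have := two_mul_triExp n
    have := two_mul_triExp (1 - n)
    zify
    nlinarith
  rw [Equiv.subLeft_apply, hT, ← inv_neg, inv_zpow', neg_sub, zpow_sub_one₀ hx']
  field_simp

/-! ### The three-term relation of theta functions -/

/-- The equivalence of `ℤ × ℤ` with two copies of itself given by the parity of `m + n`:
`(m, n)` is `(u + v, u - v)` or `(u + v + 1, u - v)`. -/
def parityEquiv : (ℤ × ℤ) ⊕ (ℤ × ℤ) ≃ ℤ × ℤ where
  toFun := Sum.elim (fun c => (c.1 + c.2, c.1 - c.2)) (fun c => (c.1 + c.2 + 1, c.1 - c.2))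
  invFun c := if (c.1 + c.2) % 2 = 0 then Sum.inl ((c.1 + c.2) / 2, (c.1 - c.2) / 2)
    else Sum.inr ((c.1 + c.2) / 2, (c.1 - c.2) / 2)
  left_inv := by
    rintro (⟨u, v⟩ | ⟨u, v⟩)
    · have h : (u + v + (u - v)) % 2 = 0 := by omega
      refine (if_pos h).trans ?_
      simp only [Sum.elim_inl, Sum.inl.injEq, Prod.mk.injEq]
      omega
    · have h : ¬ (u + v + 1 + (u - v)) % 2 = 0 := by omega
      refine (if_neg h).trans ?_
      simp only [Sum.elim_inr, Sum.inr.injEq, Prod.mk.injEq]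
      omega
  right_inv := by
    rintro ⟨m, n⟩
    dsimp only
    split_ifs with h
    · simp only [Sum.elim_inl, Prod.mk.injEq]
      omega
    · simp only [Sum.elim_inr, Prod.mk.injEq]
      omega

/-- The series `∑ p ^ (n ^ 2) x ^ (2 n)`. -/
noncomputable def evenSeries (x p : ℂ) : ℂ := ∑' n : ℤ, p ^ (n ^ 2).toNat * (x ^ 2) ^ n

/-- The series `∑ p ^ (n ^ 2 + n) x ^ (2 n)`. -/
noncomputable def oddSeries (x p : ℂ) : ℂ := ∑' n : ℤ, p ^ (2 * triExp (n + 1)) * (x ^ 2) ^ n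

/-- The double series for the product, summed separately over the pairs of exponents of `x` and `y`
that are both even and both odd, is a `2 × 2` determinant. -/
theorem thetaSeries_mul_thetaSeries {p x y : ℂ} (hp : ‖p‖ < 1) (hx : x ≠ 0) (hy : y ≠ 0) :
    thetaSeries (x * y) p * thetaSeries (x / y) p =
      x * (x * oddSeries x p * evenSeries y p - y * oddSeries y p * evenSeries x p) := by
  have sqn : ∀ n : ℤ, (((n ^ 2).toNat : ℕ) : ℤ) = n ^ 2 := fun n =>
    Int.toNat_of_nonneg (sq_nonneg n)
  have hE : ∀ z : ℂ, z ≠ 0 → Summable fun n : ℤ => ‖p ^ (n ^ 2).toNat * (z ^ 2) ^ n‖ :=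
    fun z hz => by
      refine summable_norm_pow_mul_zpow hp (pow_ne_zero 2 hz) _ fun n => ?_
      rw [sqn]
      nlinarith [abs_mul_abs_self n, abs_nonneg n]
  have hO : ∀ z : ℂ, z ≠ 0 → Summable fun n : ℤ => ‖p ^ (2 * triExp (n + 1)) * (z ^ 2) ^ n‖ :=
    fun z hz => by
      refine summable_norm_pow_mul_zpow hp (pow_ne_zero 2 hz) _ fun n => ?_
      push_cast
      rw [two_mul_triExp]
      rcases abs_cases n with ⟨h, _⟩ | ⟨h, _⟩ <;> rw [h] <;> nlinarith
  have hO' : ∀ z : ℂ, z ≠ 0 → Summable fun n : ℤ => ‖p ^ (2 * triExp n) * (z ^ 2) ^ n‖ :=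
    fun z hz => by
      refine summable_norm_pow_mul_zpow hp (pow_ne_zero 2 hz) _ fun n => ?_
      push_cast
      rw [two_mul_triExp]
      have h0 := two_mul_triExp n
      have h1 := abs_mul_pred_le_triExp n
      omega
  -- `z ^ 2 * oddSeries z` is the series `∑ p ^ (n ^ 2 - n) z ^ (2 n)` of the even part
  have hshift : ∀ z : ℂ, z ≠ 0 →
      z ^ 2 * oddSeries z p = ∑' n : ℤ, p ^ (2 * triExp n) * (z ^ 2) ^ n := fun z hz => by
    rw [← (Equiv.addRight (1 : ℤ)).tsum_eq, oddSeries, ← tsum_mul_left]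
    refine tsum_congr fun n => ?_
    rw [Equiv.coe_addRight, zpow_add_one₀ (pow_ne_zero 2 hz)]
    ring
  have hxy : -(x * y) ≠ 0 := neg_ne_zero.mpr (mul_ne_zero hx hy)
  have hxy' : -(x / y) ≠ 0 := neg_ne_zero.mpr (div_ne_zero hx hy)
  have s1 := summable_norm_pow_mul_zpow hp hxy triExp abs_mul_pred_le_triExp
  have s2 := summable_norm_pow_mul_zpow hp hxy' triExp abs_mul_pred_le_triExp
  have hprod := summable_mul_of_summable_norm s1 s2
  have hsplit := parityEquiv.summable_iff.mpr hprod
  rw [Function.comp_def] at hsplit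
  have even_term : ∀ u v : ℤ, p ^ triExp (u + v) * (-(x * y)) ^ (u + v)
      * (p ^ triExp (u - v) * (-(x / y)) ^ (u - v)) =
      p ^ (2 * triExp u) * (x ^ 2) ^ u * (p ^ (v ^ 2).toNat * (y ^ 2) ^ v) := fun u v => by
    have e : triExp (u + v) + triExp (u - v) = 2 * triExp u + (v ^ 2).toNat := by
      have h1 := two_mul_triExp (u + v)
      have h2 := two_mul_triExp (u - v)
      have h3 := two_mul_triExp u
      have h4 := sqn v
      zify at *
      nlinarith
    have e2 : (-(x * y)) ^ (u + v) * (-(x / y)) ^ (u - v) = (x ^ 2) ^ u * (y ^ 2) ^ v := by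
      rw [zpow_add₀ hxy, zpow_sub₀ hxy', mul_div_assoc', mul_right_comm, mul_div_assoc,
        ← mul_zpow, ← div_zpow]
      congr 2 <;> field_simp
    calc _ = p ^ (triExp (u + v) + triExp (u - v))
          * ((-(x * y)) ^ (u + v) * (-(x / y)) ^ (u - v)) := by rw [pow_add]; ring
      _ = _ := by rw [e, e2, pow_add]; ring
  have odd_term : ∀ u v : ℤ, p ^ triExp (u + v + 1) * (-(x * y)) ^ (u + v + 1)
      * (p ^ triExp (u - v) * (-(x / y)) ^ (u - v)) =
      -(x * y) * (p ^ (u ^ 2).toNat * (x ^ 2) ^ u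
        * (p ^ (2 * triExp (v + 1)) * (y ^ 2) ^ v)) := fun u v => by
    have e : triExp (u + v + 1) + triExp (u - v) = (u ^ 2).toNat + 2 * triExp (v + 1) := by
      have h1 := two_mul_triExp (u + v + 1)
      have h2 := two_mul_triExp (u - v)
      have h3 := two_mul_triExp (v + 1)
      have h4 := sqn u
      zify at *
      nlinarith
    have e2 : (-(x * y)) ^ (u + v) * (-(x / y)) ^ (u - v) = (x ^ 2) ^ u * (y ^ 2) ^ v := by
      rw [zpow_add₀ hxy, zpow_sub₀ hxy', mul_div_assoc', mul_right_comm, mul_div_assoc,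
        ← mul_zpow, ← div_zpow]
      congr 2 <;> field_simp
    calc _ = p ^ (triExp (u + v + 1) + triExp (u - v)) * (-(x * y))
          * ((-(x * y)) ^ (u + v) * (-(x / y)) ^ (u - v)) := by
            rw [pow_add, zpow_add_one₀ hxy]; ring
      _ = _ := by rw [e, e2, pow_add]; ring
  rw [thetaSeries, thetaSeries, tsum_mul_tsum_of_summable_norm s1 s2, ← parityEquiv.tsum_eq,
    Summable.tsum_sum (hsplit.comp_injective Sum.inl_injective)
      (hsplit.comp_injective Sum.inr_injective)]
  simp only [parityEquiv, Equiv.coe_fn_mk, Sum.elim_inl, Sum.elim_inr, even_term, odd_term]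
  rw [tsum_mul_left, ← tsum_mul_tsum_of_summable_norm (hO' x hx) (hE y hy),
    ← tsum_mul_tsum_of_summable_norm (hE x hx) (hO y hy), ← hshift x hx]
  simp only [evenSeries, oddSeries]
  ring

theorem theta_inv {p x : ℂ} (hp : ‖p‖ < 1) (hx : x ≠ 0) :
    theta x⁻¹ p = -(theta x p / x) := by
  obtain ⟨K, hK⟩ := exists_theta_eq_mul_thetaSeries hp
  rw [hK _ hx, hK _ (inv_ne_zero hx), thetaSeries_inv p hx]
  ring

/-- The Weierstrass–Riemann three-term relation. It is the Plücker relation among the `2 × 2`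
minors `θ(x y) θ(x / y) / x` of the vectors `(x * oddSeries x, evenSeries x)`. -/
theorem theta_three_term {p x y z w : ℂ} (hp : ‖p‖ < 1) (hx : x ≠ 0) (hy : y ≠ 0) (hz : z ≠ 0)
    (hw : w ≠ 0) :
    theta (x * y) p * theta (x / y) p / x * (theta (z * w) p * theta (z / w) p / z)
      + theta (y * z) p * theta (y / z) p / y * (theta (x * w) p * theta (x / w) p / x)
      + theta (z * x) p * theta (z / x) p / z * (theta (y * w) p * theta (y / w) p / y) = 0 := by
  obtain ⟨K, hK⟩ := exists_theta_eq_mul_thetaSeries hp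
  have minor : ∀ u v : ℂ, u ≠ 0 → v ≠ 0 → theta (u * v) p * theta (u / v) p / u =
      K ^ 2 * (u * oddSeries u p * evenSeries v p - v * oddSeries v p * evenSeries u p) :=
    fun u v hu hv => by
      rw [hK _ (mul_ne_zero hu hv), hK _ (div_ne_zero hu hv), mul_mul_mul_comm,
        thetaSeries_mul_thetaSeries hp hu hv]
      field_simp
  rw [minor x y hx hy, minor z w hz hw, minor y z hy hz, minor x w hx hw, minor z x hz hx,
    minor y w hy hw]
  ring

/-! ### Elliptic numbers and weights -/

/-- The product `θ(b q ^ j, a q ^ j / b; p)`. -/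
noncomputable def thetaPair (a b q p : ℂ) (j : ℤ) : ℂ :=
  theta (b * q ^ j) p * theta (a * q ^ j / b) p

/-- The three-term relation at the points `√a q ^ j`, `√a q ^ k`, `√a q ^ c`, `√a / b`. -/
theorem theta_zpow_three_term {a b q p : ℂ} (ha : a ≠ 0) (hb : b ≠ 0) (hq : q ≠ 0) (hp : ‖p‖ < 1)
    (c k j : ℤ) :
    q ^ k * (theta (q ^ (j - k)) p * theta (a * q ^ (j + k)) p) * thetaPair a b q p c
      + q ^ c * (theta (q ^ (k - c)) p * theta (a * q ^ (k + c)) p) * thetaPair a b q p j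
      = q ^ c * (theta (q ^ (j - c)) p * theta (a * q ^ (j + c)) p) * thetaPair a b q p k := by
  obtain ⟨α, hα⟩ := IsAlgClosed.exists_pow_nat_eq a (n := 2) (by norm_num)
  have hα0 : α ≠ 0 := by
    rintro rfl
    exact ha (by simpa using hα.symm)
  have nz : ∀ i : ℤ, α * q ^ i ≠ 0 := fun i => mul_ne_zero hα0 (zpow_ne_zero i hq)
  have h := theta_three_term hp (nz j) (nz k) (nz c) (div_ne_zero hα0 hb)
  have e1 : ∀ i l : ℤ, α * q ^ i * (α * q ^ l) = a * q ^ (i + l) := fun i l => by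
    rw [← hα, zpow_add₀ hq]
    ring
  have e2 : ∀ i l : ℤ, α * q ^ i / (α * q ^ l) = q ^ (i - l) := fun i l => by
    rw [zpow_sub₀ hq, mul_div_mul_left _ _ hα0]
  have e3 : ∀ i : ℤ, α * q ^ i * (α / b) = a * q ^ i / b := fun i => by
    rw [← hα]
    ring
  have e4 : ∀ i : ℤ, α * q ^ i / (α / b) = b * q ^ i := fun i => by
    field_simp
  have e5 : theta (q ^ (c - j)) p = -(theta (q ^ (j - c)) p * q ^ c / q ^ j) := by
    rw [← neg_sub j c, zpow_neg, theta_inv hp (zpow_ne_zero _ hq), zpow_sub₀ hq, div_div_eq_mul_div]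
  have e6 : ∀ i : ℤ, theta (a * q ^ i / b) p * theta (b * q ^ i) p = thetaPair a b q p i :=
    fun i => mul_comm _ _
  simp only [e1, e2, e3, e4, e5, e6] at h
  rw [add_comm c j] at h
  have hj := zpow_ne_zero j hq
  have hk := zpow_ne_zero k hq
  have hc := zpow_ne_zero c hq
  generalize q ^ j = Qj at *
  generalize q ^ k = Qk at *
  generalize q ^ c = Qc at *
  field_simp at h
  linear_combination h

/-- The elliptic number of a shifted base in terms of unshifted parameters. -/
theorem ellNumber_shift (a b p : ℂ) {q : ℂ} (hq : q ≠ 0) (c j : ℤ) :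
    ellNumber (a * q ^ (2 * c)) (b * q ^ c) q p (j - c) =
      theta (q ^ (j - c)) p * theta (a * q ^ (j + c)) p * thetaPair a b q p (c + 1) /
        (theta q p * theta (a * q ^ (2 * c + 1)) p * thetaPair a b q p j) := by
  have hc := zpow_ne_zero c hq
  have e1 : a * q ^ (2 * c) * q ^ (j - c) = a * q ^ (j + c) := by
    rw [mul_assoc, ← zpow_add₀ hq]
    ring_nf
  have e2 : b * q ^ c * q = b * q ^ (c + 1) := by rw [zpow_add_one₀ hq, mul_assoc]
  have e3 : a * q ^ (2 * c) * q / (b * q ^ c) = a * q ^ (c + 1) / b := by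
    rw [zpow_add_one₀ hq, two_mul, zpow_add₀ hq]
    field_simp
  have e4 : a * q ^ (2 * c) * q = a * q ^ (2 * c + 1) := by rw [zpow_add_one₀ hq, mul_assoc]
  have e5 : b * q ^ c * q ^ (j - c) = b * q ^ j := by
    rw [mul_assoc, ← zpow_add₀ hq]
    ring_nf
  have e6 : a * q ^ (j + c) / (b * q ^ c) = a * q ^ j / b := by
    rw [zpow_add₀ hq]
    field_simp
  simp only [ellNumber, e1, e2, e3]
  simp only [thetaPair, e4, e5, e6, mul_assoc]

theorem ellWeight_eq (a b q p : ℂ) (k : ℤ) :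
    ellWeight a b q p k = theta (a * q ^ (2 * k + 1)) p * thetaPair a b q p 0
      * thetaPair a b q p 1 /
        (theta (a * q) p * thetaPair a b q p k * thetaPair a b q p (k + 1)) * q ^ k := by
  simp only [ellWeight, thetaPair, zpow_zero, zpow_one, mul_one]
  congr 2 <;> ring

theorem ellNumber_eq (a b q p : ℂ) (j : ℤ) :
    ellNumber a b q p j = theta (q ^ j) p * theta (a * q ^ j) p * thetaPair a b q p 1 /
        (theta q p * theta (a * q) p * thetaPair a b q p j) := by
  simp only [ellNumber, thetaPair, zpow_one, mul_assoc]

/-- Genericity of the parameters: the theta functions that occur as factors of the elliptic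
weights and in the denominators of the elliptic numbers do not vanish. -/
structure IsGeneric (a b q p : ℂ) (n N : ℕ) : Prop where
  a_ne_zero : a ≠ 0
  b_ne_zero : b ≠ 0
  q_ne_zero : q ≠ 0
  norm_lt_one : ‖p‖ < 1
  theta_q : ∀ m : ℤ, 1 ≤ m → m ≤ (n : ℤ) → theta (q ^ m) p ≠ 0
  theta_a : ∀ m : ℤ, -(2 * (N : ℤ)) < m → m ≤ 2 * (n : ℤ) + 1 → theta (a * q ^ m) p ≠ 0
  theta_b : ∀ m : ℤ, -(N : ℤ) ≤ m → m ≤ (n : ℤ) + 1 → theta (b * q ^ m) p ≠ 0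
  theta_ab : ∀ m : ℤ, -(N : ℤ) ≤ m → m ≤ (n : ℤ) + 1 → theta (a * q ^ m / b) p ≠ 0

namespace IsGeneric

variable {a b q p : ℂ} {n N : ℕ}

theorem thetaPair_ne_zero (hg : IsGeneric a b q p n N) {m : ℤ} (h1 : -(N : ℤ) ≤ m)
    (h2 : m ≤ (n : ℤ) + 1) : thetaPair a b q p m ≠ 0 :=
  mul_ne_zero (hg.theta_b m h1 h2) (hg.theta_ab m h1 h2)

theorem theta_a_mul_q_ne_zero (hg : IsGeneric a b q p n N) : theta (a * q) p ≠ 0 := by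
  simpa using hg.theta_a 1 (by omega) (by omega)

theorem ellWeight_ne_zero (hg : IsGeneric a b q p n N) {c : ℤ} (h1 : -(N : ℤ) ≤ c)
    (h2 : c ≤ (n : ℤ)) : ellWeight a b q p c ≠ 0 := by
  rw [ellWeight_eq]
  have t1 := hg.theta_a (2 * c + 1) (by omega) (by omega)
  have t2 := hg.thetaPair_ne_zero (m := 0) (by omega) (by omega)
  have t3 := hg.thetaPair_ne_zero (m := 1) (by omega) (by omega)
  have t4 := hg.thetaPair_ne_zero (m := c) (by omega) (by omega)
  have t5 := hg.thetaPair_ne_zero (m := c + 1) (by omega) (by omega)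
  exact mul_ne_zero (div_ne_zero (mul_ne_zero (mul_ne_zero t1 t2) t3)
    (mul_ne_zero (mul_ne_zero hg.theta_a_mul_q_ne_zero t4) t5)) (zpow_ne_zero _ hg.q_ne_zero)

theorem ellCellWeight_mul (hg : IsGeneric a b q p n N) {z : ℤ} (h1 : -(N : ℤ) < z)
    (h2 : z ≤ (n : ℤ)) :
    ellCellWeight a b q p z * ellWeight a b q p (z - 1) = ellWeight a b q p z := by
  have t0 := hg.theta_a_mul_q_ne_zero
  have t1 := hg.theta_a (2 * z - 1) (by omega) (by omega)
  have t4 := hg.thetaPair_ne_zero (m := z) (by omega) (by omega)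
  have t5 := hg.thetaPair_ne_zero (m := z + 1) (by omega) (by omega)
  have t6 := hg.thetaPair_ne_zero (m := z - 1) (by omega) (by omega)
  have hq := hg.q_ne_zero
  have hw : ellCellWeight a b q p z = theta (a * q ^ (2 * z + 1)) p * thetaPair a b q p (z - 1) /
      (theta (a * q ^ (2 * z - 1)) p * thetaPair a b q p (z + 1)) * q := by
    simp only [ellCellWeight, thetaPair, mul_assoc]
  rw [hw, ellWeight_eq, ellWeight_eq, show 2 * (z - 1) + 1 = 2 * z - 1 by ring, sub_add_cancel,
    show q ^ z = q ^ (z - 1) * q by rw [← zpow_add_one₀ hq, sub_add_cancel]]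
  generalize theta (a * q ^ (2 * z - 1)) p = T at *
  field_simp

/-- The elliptic numbers of shifted base are the normalized differences of the elliptic numbers
`[j]_{a,b;q,p}`. -/
theorem ellWeight_mul_ellNumber (hg : IsGeneric a b q p n N) {c j : ℤ} (hc1 : -(N : ℤ) ≤ c)
    (hc2 : c ≤ (n : ℤ)) (hj1 : -(N : ℤ) ≤ j) (hj2 : j ≤ (n : ℤ)) :
    ellWeight a b q p c * ellNumber (a * q ^ (2 * c)) (b * q ^ c) q p (j - c) =
      ellNumber a b q p j - ellNumber a b q p c := by
  have t0 := hg.theta_a_mul_q_ne_zero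
  have t1 := hg.theta_a (2 * c + 1) (by omega) (by omega)
  have t2 := hg.thetaPair_ne_zero (m := 0) (by omega) (by omega)
  have t4 := hg.thetaPair_ne_zero (m := c) (by omega) (by omega)
  have t5 := hg.thetaPair_ne_zero (m := c + 1) (by omega) (by omega)
  have t6 := hg.thetaPair_ne_zero (m := j) (by omega) (by omega)
  have key := theta_zpow_three_term hg.a_ne_zero hg.b_ne_zero hg.q_ne_zero hg.norm_lt_one 0 c j
  simp only [sub_zero, add_zero, zpow_zero, one_mul] at key
  rw [ellNumber_shift a b p hg.q_ne_zero, ellWeight_eq, ellNumber_eq, ellNumber_eq]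
  -- for `n = 0` genericity allows `θ(q; p) = 0`; then both sides are `0` by division by zero
  rcases eq_or_ne (theta q p) 0 with h0 | h0
  · simp [h0]
  field_simp
  linear_combination thetaPair a b q p 1 * key

theorem ellNumber_add_one (hg : IsGeneric a b q p n N) {z : ℤ} (h1 : -(N : ℤ) ≤ z)
    (h2 : z + 1 ≤ (n : ℤ)) (hn : 1 ≤ n) :
    ellNumber a b q p (z + 1) = ellNumber a b q p z + ellWeight a b q p z := by
  have h := hg.ellWeight_mul_ellNumber (c := z) (j := z + 1) h1 (by omega) (by omega) h2
  have t1 := hg.theta_a (2 * z + 1) (by omega) (by omega)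
  have t5 := hg.thetaPair_ne_zero (m := z + 1) (by omega) (by omega)
  have tq := hg.theta_q 1 le_rfl (by exact_mod_cast hn)
  rw [ellNumber_shift a b p hg.q_ne_zero, show z + 1 - z = 1 by ring,
    show z + 1 + z = 2 * z + 1 by ring, zpow_one, div_self
      (mul_ne_zero (mul_ne_zero (by simpa using tq) t1) t5), mul_one] at h
  rw [h]
  ring

theorem ellNumber_ne {j c : ℕ} (hg : IsGeneric a b q p n N) (hjc : c < j) (hj : j ≤ n) :
    ellNumber a b q p j ≠ ellNumber a b q p c := by
  have h := hg.ellWeight_mul_ellNumber (c := c) (j := j) (by omega) (by omega) (by omega) (by omega)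
  rw [← sub_ne_zero, ← h, ellNumber_shift a b p hg.q_ne_zero]
  have tq := hg.theta_q 1 le_rfl (by omega)
  rw [zpow_one] at tq
  have t1 := hg.theta_q (j - c) (by omega) (by omega)
  have t2 := hg.theta_a (j + c) (by omega) (by omega)
  have t3 := hg.thetaPair_ne_zero (m := c + 1) (by omega) (by omega)
  have t4 := hg.theta_a (2 * c + 1) (by omega) (by omega)
  have t5 := hg.thetaPair_ne_zero (m := j) (by omega) (by omega)
  exact mul_ne_zero (hg.ellWeight_ne_zero (by omega) (by omega))
    (div_ne_zero (mul_ne_zero (mul_ne_zero t1 t2) t3) (mul_ne_zero (mul_ne_zero tq t4) t5))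

end IsGeneric

/-! ### The last column of a Ferrers board -/

theorem mem_rookPlacements {B : Finset (ℕ × ℕ)} {k : ℕ} {P : Finset (ℕ × ℕ)} :
    P ∈ rookPlacements B k ↔
      P ⊆ B ∧ P.card = k ∧ ∀ c ∈ P, ∀ d ∈ P, c ≠ d → c.1 ≠ d.1 ∧ c.2 ≠ d.2 := by
  simp only [rookPlacements, Finset.mem_filter, Finset.mem_powersetCard, and_assoc]

/-- The rows in `{1, …, H}` without a rook of `P`. -/
def freeRows (H : ℕ) (P : Finset (ℕ × ℕ)) : Finset ℕ := Finset.Icc 1 H \ P.image Prod.snd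

theorem mem_freeRows {H : ℕ} {P : Finset (ℕ × ℕ)} {j : ℕ} :
    j ∈ freeRows H P ↔ (1 ≤ j ∧ j ≤ H) ∧ ∀ d ∈ P, d.2 ≠ j := by
  simp only [freeRows, Finset.mem_sdiff, Finset.mem_Icc, Finset.mem_image, not_exists, not_and]

/-- The number the row `j` gets in the cell weights of a new last column: `j` plus the number of
occupied rows above it. -/
def rowLabel (S : Finset ℕ) (j : ℕ) : ℕ := j + (S.filter fun s => j < s).card

/-- Between rows `i < j` the occupied rows number less than `j - i` if `j` is free. -/
theorem rowLabel_lt_rowLabel {S : Finset ℕ} {i j : ℕ} (hij : i < j) (hj : j ∉ S) :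
    rowLabel S i < rowLabel S j := by
  have hsub : (S.filter fun s => i < s) ⊆ (S.filter fun s => j < s) ∪ Finset.Ioo i j := by
    intro s hs
    obtain ⟨h1, h2⟩ := Finset.mem_filter.mp hs
    have : s ≠ j := fun h => hj (h ▸ h1)
    simp only [Finset.mem_union, Finset.mem_filter, Finset.mem_Ioo]
    by_cases h : j < s
    · exact Or.inl ⟨h1, h⟩
    · exact Or.inr ⟨h2, by omega⟩
  have hcard := (Finset.card_le_card hsub).trans (Finset.card_union_le _ _)
  rw [Nat.card_Ioo] at hcard
  unfold rowLabel
  omega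

theorem rowLabel_injOn (S : Finset ℕ) (H : ℕ) :
    Set.InjOn (rowLabel S) (Finset.Icc 1 H \ S : Finset ℕ) := by
  intro i hi j hj h
  have hi' := (Finset.mem_sdiff.mp (Finset.mem_coe.mp hi)).2
  have hj' := (Finset.mem_sdiff.mp (Finset.mem_coe.mp hj)).2
  rcases lt_trichotomy i j with hlt | heq | hlt
  · exact absurd h (rowLabel_lt_rowLabel hlt hj').ne
  · exact heq
  · exact absurd h (rowLabel_lt_rowLabel hlt hi').ne'

/-- The free rows receive the labels `#S + 1, …, H`, in increasing order. -/
theorem image_rowLabel {S : Finset ℕ} {H : ℕ} (hS : S ⊆ Finset.Icc 1 H) :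
    (Finset.Icc 1 H \ S).image (rowLabel S) = Finset.Icc (S.card + 1) H := by
  have hinj := rowLabel_injOn S H
  refine Finset.eq_of_subset_of_card_le ?_ ?_
  · intro t ht
    obtain ⟨j, hj, rfl⟩ := Finset.mem_image.mp ht
    obtain ⟨hj1, hj2⟩ := Finset.mem_sdiff.mp hj
    rw [Finset.mem_Icc] at hj1
    have hsplit := Finset.card_filter_add_card_filter_not (s := S) (fun s => j < s)
    have hup : (S.filter fun s => j < s).card ≤ H - j := by
      rw [← Nat.card_Ioc]
      refine Finset.card_le_card fun s hs => ?_
      obtain ⟨h1, h2⟩ := Finset.mem_filter.mp hs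
      exact Finset.mem_Ioc.mpr ⟨h2, (Finset.mem_Icc.mp (hS h1)).2⟩
    have hlow : (S.filter fun s => ¬ j < s).card ≤ j - 1 := by
      rw [← Nat.card_Ico]
      refine Finset.card_le_card fun s hs => ?_
      obtain ⟨h1, h2⟩ := Finset.mem_filter.mp hs
      have : s ≠ j := fun h => hj2 (h ▸ h1)
      exact Finset.mem_Ico.mpr ⟨(Finset.mem_Icc.mp (hS h1)).1, by omega⟩
    rw [Finset.mem_Icc]
    unfold rowLabel
    omega
  · rw [Finset.card_image_of_injOn hinj, Finset.card_sdiff_of_subset hS, Nat.card_Icc, Nat.card_Icc]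
    omega

theorem prod_rowLabel {S : Finset ℕ} {H : ℕ} (hS : S ⊆ Finset.Icc 1 H) (f : ℕ → ℂ) :
    ∏ j ∈ Finset.Icc 1 H \ S, f (rowLabel S j) = ∏ t ∈ Finset.Icc (S.card + 1) H, f t := by
  rw [← image_rowLabel hS, Finset.prod_image (rowLabel_injOn S H)]

/-- The sum over the free rows `i` for a rook, of the product over the free rows above `i`. -/
theorem sum_prod_rowLabel {S : Finset ℕ} {H : ℕ} (hS : S ⊆ Finset.Icc 1 H) (f : ℕ → ℂ) :
    ∑ i ∈ Finset.Icc 1 H \ S, ∏ j ∈ (Finset.Icc 1 H \ S).filter (fun j => i < j), f (rowLabel S j) =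
      ∑ t ∈ Finset.Icc (S.card + 1) H, ∏ u ∈ Finset.Ioc t H, f u := by
  have hinj := rowLabel_injOn S H
  have himg := image_rowLabel hS
  rw [← himg, Finset.sum_image hinj]
  refine Finset.sum_congr rfl fun i hi => ?_
  have hiS := (Finset.mem_sdiff.mp hi).2
  have : Finset.Ioc (rowLabel S i) H =
      ((Finset.Icc 1 H \ S).filter fun j => i < j).image (rowLabel S) := by
    ext t
    rw [Finset.mem_Ioc, Finset.mem_image]
    constructor
    · rintro ⟨h1, h2⟩
      have hi' : rowLabel S i ∈ Finset.Icc (S.card + 1) H := himg ▸ Finset.mem_image_of_mem _ hi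
      have ht : t ∈ Finset.Icc (S.card + 1) H :=
        Finset.mem_Icc.mpr ⟨(Finset.mem_Icc.mp hi').1.trans h1.le, h2⟩
      rw [← himg] at ht
      obtain ⟨j, hj, rfl⟩ := Finset.mem_image.mp ht
      refine ⟨j, Finset.mem_filter.mpr ⟨hj, ?_⟩, rfl⟩
      by_contra hle
      rcases (not_lt.mp hle).lt_or_eq with h | h
      · exact absurd h1 (rowLabel_lt_rowLabel h hiS).not_gt
      · exact absurd h1 (by rw [h]; exact lt_irrefl _)
    · rintro ⟨j, hj, rfl⟩
      obtain ⟨hj1, hj2⟩ := Finset.mem_filter.mp hj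
      have hj' : rowLabel S j ∈ Finset.Icc (S.card + 1) H := himg ▸ Finset.mem_image_of_mem _ hj1
      exact ⟨rowLabel_lt_rowLabel hj2 (Finset.mem_sdiff.mp hj1).2, (Finset.mem_Icc.mp hj').2⟩
  rw [this, Finset.prod_image]
  exact hinj.mono (by
    intro j hj
    exact Finset.mem_coe.mpr (Finset.mem_filter.mp (Finset.mem_coe.mp hj)).1)

section Column

variable {n : ℕ} {h : ℕ → ℕ} {P : Finset (ℕ × ℕ)}

theorem fst_le_of_subset (hP : P ⊆ ferrersBoard n h) {d : ℕ × ℕ} (hd : d ∈ P) : d.1 ≤ n :=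
  ((mem_ferrersBoard n h d).mp (hP hd)).1.2

/-- The cell weights of a last column, before any rook is placed there. -/
theorem placementWeight_succ_of_subset (a b q p : ℂ) (hP : P ⊆ ferrersBoard n h) :
    placementWeight a b q p (ferrersBoard (n + 1) h) P =
      placementWeight a b q p (ferrersBoard n h) P *
        ∏ j ∈ freeRows (h (n + 1)) P, ellCellWeight a b q p
          ((n + 1 : ℤ) - (j : ℤ) - ((P.filter fun d => j < d.2).card : ℤ)) := by
  have hfst := fun d hd => fst_le_of_subset (d := d) hP hd
  rw [placementWeight, ← Finset.prod_filter_mul_prod_filter_not _ (fun c => c.1 ≤ n)]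
  congr 1
  · refine Finset.prod_congr ?_ fun _ _ => rfl
    ext c
    simp only [uncancelled, Finset.mem_filter, Finset.mem_sdiff, mem_ferrersBoard]
    grind
  · have hset : (uncancelled (ferrersBoard (n + 1) h) P).filter (fun c => ¬ c.1 ≤ n) =
        (freeRows (h (n + 1)) P).image fun j => (n + 1, j) := by
      ext ⟨i, j⟩
      simp only [uncancelled, Finset.mem_filter, Finset.mem_sdiff, mem_ferrersBoard,
        Finset.mem_image, mem_freeRows, Prod.mk.injEq]
      refine ⟨fun hc => ⟨j, ?_⟩, ?_⟩ <;> grind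
    rw [hset, Finset.prod_image (by simp)]
    refine Finset.prod_congr rfl fun j _ => ?_
    have : northWest P (n + 1, j) = (P.filter fun d => j < d.2).card := by
      unfold northWest
      congr 1
      refine Finset.filter_congr fun d hd => ?_
      have := hfst d hd
      simp only
      omega
    rw [this]
    push_cast
    rfl

/-- A rook in row `j` of a last column leaves there the free cells above it. -/
theorem placementWeight_succ_insert (a b q p : ℂ) (hP : P ⊆ ferrersBoard n h) {j : ℕ}
    (hj : j ∈ freeRows (h (n + 1)) P) :
    placementWeight a b q p (ferrersBoard (n + 1) h) (insert (n + 1, j) P) =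
      placementWeight a b q p (ferrersBoard n h) P *
        ∏ i ∈ (freeRows (h (n + 1)) P).filter (fun i => j < i), ellCellWeight a b q p
          ((n + 1 : ℤ) - (i : ℤ) - ((P.filter fun d => i < d.2).card : ℤ)) := by
  have hfst := fun d hd => fst_le_of_subset (d := d) hP hd
  have hj' := mem_freeRows.mp hj
  rw [placementWeight, ← Finset.prod_filter_mul_prod_filter_not _ (fun c => c.1 ≤ n)]
  congr 1
  · have hset : (uncancelled (ferrersBoard (n + 1) h) (insert (n + 1, j) P)).filter
        (fun c => c.1 ≤ n) = uncancelled (ferrersBoard n h) P := by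
      ext ⟨i, l⟩
      simp only [uncancelled, Finset.mem_filter, Finset.mem_sdiff, mem_ferrersBoard,
        Finset.mem_insert, Prod.mk.injEq]
      grind
    rw [hset]
    refine Finset.prod_congr rfl fun c hc => ?_
    have hc1 : c.1 ≤ n := by
      have := (Finset.mem_sdiff.mp (Finset.mem_filter.mp hc).1).1
      exact ((mem_ferrersBoard n h c).mp this).1.2
    rw [northWest, Finset.filter_insert, if_neg (by simp only; omega), northWest]
  · have hset : (uncancelled (ferrersBoard (n + 1) h) (insert (n + 1, j) P)).filter
        (fun c => ¬ c.1 ≤ n) =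
        ((freeRows (h (n + 1)) P).filter fun i => j < i).image fun i => (n + 1, i) := by
      ext ⟨i, l⟩
      simp only [uncancelled, Finset.mem_filter, Finset.mem_sdiff, mem_ferrersBoard,
        Finset.mem_image, mem_freeRows, Finset.mem_insert, forall_eq_or_imp, Prod.mk.injEq]
      refine ⟨fun hc => ⟨l, ?_⟩, ?_⟩ <;> grind
    rw [hset, Finset.prod_image (by simp)]
    refine Finset.prod_congr rfl fun i _ => ?_
    have : northWest (insert (n + 1, j) P) (n + 1, i) = (P.filter fun d => i < d.2).card := by
      rw [northWest, Finset.filter_insert, if_neg (by simp)]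
      congr 1
      refine Finset.filter_congr fun d hd => ?_
      have := hfst d hd
      simp only
      omega
    rw [this]
    push_cast
    rfl

theorem snd_injOn_of_mem_rookPlacements {B : Finset (ℕ × ℕ)} {k : ℕ}
    (hP : P ∈ rookPlacements B k) : Set.InjOn Prod.snd (P : Set (ℕ × ℕ)) := by
  intro c hc d hd hcd
  by_contra hne
  exact ((mem_rookPlacements.mp hP).2.2 c hc d hd hne).2 hcd

theorem card_filter_snd {B : Finset (ℕ × ℕ)} {k : ℕ} (hP : P ∈ rookPlacements B k) (j : ℕ) :
    (P.filter fun d => j < d.2).card = ((P.image Prod.snd).filter fun s => j < s).card := by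
  rw [Finset.filter_image, Finset.card_image_of_injOn]
  exact (snd_injOn_of_mem_rookPlacements hP).mono (by
    intro d hd
    exact Finset.mem_coe.mpr (Finset.mem_filter.mp (Finset.mem_coe.mp hd)).1)

theorem image_snd_subset (hh : ∀ i ∈ Finset.Icc 1 n, h i ≤ h (n + 1))
    (hP : P ⊆ ferrersBoard n h) : P.image Prod.snd ⊆ Finset.Icc 1 (h (n + 1)) := by
  intro s hs
  obtain ⟨d, hd, rfl⟩ := Finset.mem_image.mp hs
  obtain ⟨h1, h2⟩ := (mem_ferrersBoard n h d).mp (hP hd)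
  exact Finset.mem_Icc.mpr ⟨h2.1, h2.2.trans (hh _ (Finset.mem_Icc.mpr h1))⟩

/-- An empty last column multiplies the weight by a factor that depends only on the number of
rooks. -/
theorem placementWeight_succ (a b q p : ℂ) (hh : ∀ i ∈ Finset.Icc 1 n, h i ≤ h (n + 1)) {k : ℕ}
    (hP : P ∈ rookPlacements (ferrersBoard n h) k) :
    placementWeight a b q p (ferrersBoard (n + 1) h) P =
      (∏ t ∈ Finset.Icc (k + 1) (h (n + 1)), ellCellWeight a b q p ((n + 1 : ℤ) - (t : ℤ))) *
        placementWeight a b q p (ferrersBoard n h) P := by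
  obtain ⟨hsub, hcard, -⟩ := mem_rookPlacements.mp hP
  have hS := image_snd_subset hh hsub
  have hSc : (P.image Prod.snd).card = k := by
    rw [Finset.card_image_of_injOn (snd_injOn_of_mem_rookPlacements hP), hcard]
  rw [placementWeight_succ_of_subset a b q p hsub, mul_comm]
  congr 1
  have := prod_rowLabel hS fun t => ellCellWeight a b q p ((n + 1 : ℤ) - (t : ℤ))
  rw [hSc] at this
  rw [← this]
  refine Finset.prod_congr rfl fun j _ => ?_
  rw [card_filter_snd hP, rowLabel]
  push_cast
  rw [sub_sub]

/-- Summed over the possible rooks in the last column, the weight is multiplied by a factor that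
depends only on the number of rooks. -/
theorem sum_placementWeight_succ (a b q p : ℂ) (hh : ∀ i ∈ Finset.Icc 1 n, h i ≤ h (n + 1)) {k : ℕ}
    (hP : P ∈ rookPlacements (ferrersBoard n h) k) :
    ∑ j ∈ freeRows (h (n + 1)) P,
      placementWeight a b q p (ferrersBoard (n + 1) h) (insert (n + 1, j) P) =
      (∑ t ∈ Finset.Icc (k + 1) (h (n + 1)), ∏ u ∈ Finset.Ioc t (h (n + 1)),
        ellCellWeight a b q p ((n + 1 : ℤ) - (u : ℤ))) *
        placementWeight a b q p (ferrersBoard n h) P := by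
  obtain ⟨hsub, hcard, -⟩ := mem_rookPlacements.mp hP
  have hS := image_snd_subset hh hsub
  have hSc : (P.image Prod.snd).card = k := by
    rw [Finset.card_image_of_injOn (snd_injOn_of_mem_rookPlacements hP), hcard]
  have := sum_prod_rowLabel hS fun t => ellCellWeight a b q p ((n + 1 : ℤ) - (t : ℤ))
  rw [hSc] at this
  rw [← this, mul_comm, Finset.mul_sum]
  refine Finset.sum_congr rfl fun j hj => ?_
  rw [placementWeight_succ_insert a b q p hsub hj]
  congr 1
  refine Finset.prod_congr rfl fun i _ => ?_
  rw [card_filter_snd hP, rowLabel]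
  push_cast
  rw [sub_sub]

theorem rookPlacements_filter_fst_le (n : ℕ) (h : ℕ → ℕ) (k : ℕ) :
    (rookPlacements (ferrersBoard (n + 1) h) k).filter (fun P => ∀ d ∈ P, d.1 ≤ n) =
      rookPlacements (ferrersBoard n h) k := by
  ext P
  simp only [Finset.mem_filter, mem_rookPlacements, Finset.subset_iff, mem_ferrersBoard]
  grind

theorem ellRook_succ_zero (a b q p : ℂ) (hh : ∀ i ∈ Finset.Icc 1 n, h i ≤ h (n + 1)) :
    ellRook a b q p (ferrersBoard (n + 1) h) 0 =
      (∏ t ∈ Finset.Icc 1 (h (n + 1)), ellCellWeight a b q p ((n + 1 : ℤ) - (t : ℤ))) *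
        ellRook a b q p (ferrersBoard n h) 0 := by
  have hset : rookPlacements (ferrersBoard (n + 1) h) 0 = rookPlacements (ferrersBoard n h) 0 := by
    rw [← rookPlacements_filter_fst_le n, Finset.filter_true_of_mem]
    intro P hP d hd
    rw [Finset.card_eq_zero.mp (mem_rookPlacements.mp hP).2.1] at hd
    simp at hd
  rw [ellRook, ellRook, hset, Finset.mul_sum]
  exact Finset.sum_congr rfl fun P hP => placementWeight_succ a b q p hh hP

/-- Recursion for the rook numbers: a placement either leaves the last column empty or has exactly
one rook in it, in a free row. -/
theorem ellRook_succ_succ (a b q p : ℂ) (hh : ∀ i ∈ Finset.Icc 1 n, h i ≤ h (n + 1)) (k : ℕ) :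
    ellRook a b q p (ferrersBoard (n + 1) h) (k + 1) =
      (∏ t ∈ Finset.Icc (k + 2) (h (n + 1)), ellCellWeight a b q p ((n + 1 : ℤ) - (t : ℤ))) *
        ellRook a b q p (ferrersBoard n h) (k + 1) +
      (∑ t ∈ Finset.Icc (k + 1) (h (n + 1)), ∏ u ∈ Finset.Ioc t (h (n + 1)),
        ellCellWeight a b q p ((n + 1 : ℤ) - (u : ℤ))) *
        ellRook a b q p (ferrersBoard n h) k := by
  rw [ellRook, ← Finset.sum_filter_add_sum_filter_not _ (fun P => ∀ d ∈ P, d.1 ≤ n),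
    rookPlacements_filter_fst_le]
  congr 1
  · rw [ellRook, Finset.mul_sum]
    exact Finset.sum_congr rfl fun P hP => placementWeight_succ a b q p hh hP
  · rw [ellRook, Finset.mul_sum,
      ← Finset.sum_congr rfl fun P hP => sum_placementWeight_succ a b q p hh hP, Finset.sum_sigma']
    symm
    refine Finset.sum_bij (fun x _ => insert (n + 1, x.2) x.1) ?_ ?_ ?_ fun _ _ => rfl
    · rintro ⟨P, j⟩ hx
      obtain ⟨hP, hj⟩ := Finset.mem_sigma.mp hx
      obtain ⟨hsub, hcard, hne⟩ := mem_rookPlacements.mp hP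
      have hfst := fun d hd => fst_le_of_subset (d := d) hsub hd
      have hj' := mem_freeRows.mp hj
      dsimp only at hj' hsub hcard hne hfst ⊢
      have hnot : (n + 1, j) ∉ P := fun hm => by simpa using hfst _ hm
      rw [Finset.mem_filter, mem_rookPlacements, Finset.card_insert_of_notMem hnot, hcard]
      refine ⟨⟨?_, rfl, ?_⟩, fun hall => ?_⟩
      · intro c hc
        rw [mem_ferrersBoard]
        rcases Finset.mem_insert.mp hc with rfl | hc
        · exact ⟨by simp, hj'.1⟩
        · have := (mem_ferrersBoard n h c).mp (hsub hc)
          exact ⟨⟨this.1.1, by omega⟩, this.2⟩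
      · intro c hc d hd hcd
        rcases Finset.mem_insert.mp hc with rfl | hc' <;>
          rcases Finset.mem_insert.mp hd with rfl | hd'
        · exact absurd rfl hcd
        · have := hfst d hd'
          exact ⟨by simp only; omega, (hj'.2 d hd').symm⟩
        · have := hfst c hc'
          exact ⟨by simp only; omega, hj'.2 c hc'⟩
        · exact hne c hc' d hd' hcd
      · simpa using hall _ (Finset.mem_insert_self _ _)
    · rintro ⟨P, j⟩ hx ⟨P', j'⟩ hx' heq
      have hsub := (mem_rookPlacements.mp (Finset.mem_sigma.mp hx).1).1
      have hsub' := (mem_rookPlacements.mp (Finset.mem_sigma.mp hx').1).1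
      have hfst := fun d hd => fst_le_of_subset (d := d) hsub hd
      have hfst' := fun d hd => fst_le_of_subset (d := d) hsub' hd
      dsimp only at heq hfst hfst'
      have hnot : (n + 1, j) ∉ P := fun hm => by simpa using hfst _ hm
      have hnot' : ∀ i, (n + 1, i) ∉ P' := fun i hm => by simpa using hfst' _ hm
      have hjj : j = j' := by
        have : (n + 1, j) ∈ insert (n + 1, j') P' := heq ▸ Finset.mem_insert_self _ _
        rcases Finset.mem_insert.mp this with h1 | h1
        · simpa using h1
        · exact absurd h1 (hnot' j)
      subst hjj
      have hPP : P = P' := by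
        rw [← Finset.erase_insert hnot, heq, Finset.erase_insert (hnot' j)]
      rw [hPP]
    · intro P hP
      obtain ⟨hP, hex⟩ := Finset.mem_filter.mp hP
      obtain ⟨hsub, hcard, hne⟩ := mem_rookPlacements.mp hP
      push Not at hex
      obtain ⟨⟨i, j⟩, hd, hi⟩ := hex
      have hB := (mem_ferrersBoard _ h _).mp (hsub hd)
      dsimp only at hi hB
      obtain rfl : i = n + 1 := by omega
      refine ⟨⟨P.erase (n + 1, j), j⟩, Finset.mem_sigma.mpr ⟨?_, ?_⟩, Finset.insert_erase hd⟩
      · rw [mem_rookPlacements, Finset.card_erase_of_mem hd, hcard]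
        refine ⟨fun c hc => ?_, rfl, fun c hc d hd => hne c (Finset.mem_of_mem_erase hc) d
          (Finset.mem_of_mem_erase hd)⟩
        obtain ⟨hc1, hc2⟩ := Finset.mem_erase.mp hc
        have h1 := (mem_ferrersBoard _ h c).mp (hsub hc2)
        have h2 := (hne c hc2 _ hd hc1).1
        rw [mem_ferrersBoard]
        dsimp only at h2
        exact ⟨⟨h1.1.1, by omega⟩, h1.2⟩
      · refine mem_freeRows.mpr ⟨hB.2, fun c hc => ?_⟩
        obtain ⟨hc1, hc2⟩ := Finset.mem_erase.mp hc
        exact (hne c hc2 _ hd hc1).2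

theorem ellRook_eq_zero_of_forall_lt (a b q p : ℂ) {H k : ℕ} (hH : ∀ i ∈ Finset.Icc 1 n, h i ≤ H)
    (hk : H < k) : ellRook a b q p (ferrersBoard n h) k = 0 := by
  refine Finset.sum_eq_zero fun P hP => ?_
  obtain ⟨hsub, hcard, -⟩ := mem_rookPlacements.mp hP
  have hle : (P.image Prod.snd).card ≤ (Finset.Icc 1 H).card := by
    refine Finset.card_le_card fun s hs => ?_
    obtain ⟨d, hd, rfl⟩ := Finset.mem_image.mp hs
    obtain ⟨h1, h2⟩ := (mem_ferrersBoard n h d).mp (hsub hd)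
    exact Finset.mem_Icc.mpr ⟨h2.1, h2.2.trans (hH _ (Finset.mem_Icc.mpr h1))⟩
  rw [Finset.card_image_of_injOn (snd_injOn_of_mem_rookPlacements hP), hcard, Nat.card_Icc] at hle
  omega

theorem ellRook_eq_zero_of_lt (a b q p : ℂ) (h : ℕ → ℕ) {k : ℕ} (hk : n < k) :
    ellRook a b q p (ferrersBoard n h) k = 0 := by
  refine Finset.sum_eq_zero fun P hP => ?_
  obtain ⟨hsub, hcard, hne⟩ := mem_rookPlacements.mp hP
  have hinj : Set.InjOn Prod.fst (P : Set (ℕ × ℕ)) := by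
    intro c hc d hd hcd
    by_contra hcd'
    exact (hne c hc d hd hcd').1 hcd
  have hle : (P.image Prod.fst).card ≤ (Finset.Icc 1 n).card := by
    refine Finset.card_le_card fun s hs => ?_
    obtain ⟨d, hd, rfl⟩ := Finset.mem_image.mp hs
    exact Finset.mem_Icc.mpr ((mem_ferrersBoard n h d).mp (hsub hd)).1
  rw [Finset.card_image_of_injOn hinj, hcard, Nat.card_Icc] at hle
  omega

end Column

/-! ### Telescoping products of cell weights -/

namespace IsGeneric

variable {a b q p : ℂ} {n N : ℕ}

theorem prod_ellCellWeight (hg : IsGeneric a b q p n N) {m t H : ℕ} (hm : m ≤ n) (htH : t ≤ H)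
    (hHN : H ≤ N) :
    ∏ u ∈ Finset.Ioc t H, ellCellWeight a b q p ((m + 1 : ℤ) - (u : ℤ)) =
      ellWeight a b q p (m - t) / ellWeight a b q p (m - H) := by
  rw [eq_div_iff (hg.ellWeight_ne_zero (by omega) (by omega))]
  -- the product telescopes
  induction H, htH using Nat.le_induction with
  | base => simp
  | succ H htH ih =>
    rw [← ih (by omega), Finset.prod_Ioc_succ_top (by omega), mul_assoc]
    congr 1
    have h := hg.ellCellWeight_mul (z := (m : ℤ) - H) (by omega) (by omega)
    rw [← h]
    push_cast
    congr 2 <;> ring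

theorem sum_prod_ellCellWeight (hg : IsGeneric a b q p n N) {m k H : ℕ} (hm : m < n) (hkH : k ≤ H)
    (hHN : H ≤ N) :
    ∑ t ∈ Finset.Icc (k + 1) H, ∏ u ∈ Finset.Ioc t H,
        ellCellWeight a b q p ((m + 1 : ℤ) - (u : ℤ)) =
      (ellNumber a b q p (m - k) - ellNumber a b q p (m - H)) / ellWeight a b q p (m - H) := by
  have hsum : ∑ t ∈ Finset.Icc (k + 1) H, ellWeight a b q p (m - t) =
      ellNumber a b q p (m - k) - ellNumber a b q p (m - H) := by
    induction H, hkH using Nat.le_induction with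
    | base => simp
    | succ H hkH ih =>
      rw [Finset.sum_Icc_succ_top (by omega), ih (by omega)]
      have h := hg.ellNumber_add_one (z := (m : ℤ) - (H + 1 : ℕ)) (by omega) (by omega) (by omega)
      rw [show (m : ℤ) - (H + 1 : ℕ) + 1 = m - H by push_cast; ring] at h
      rw [h]
      ring
  rw [← hsum, Finset.sum_div]
  refine Finset.sum_congr rfl fun t ht => ?_
  exact hg.prod_ellCellWeight hm.le (Finset.mem_Icc.mp ht).2 hHN

end IsGeneric

/-! ### Divided differences -/

/-- The divided difference, with weights, at the nodes `S 0, …, S k` of the polynomial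
`∏ (X - S (c i)) / W (c i)`, `i` from `1` to `m`. -/
noncomputable def weightedDivDiff (W S : ℤ → ℂ) (c : ℕ → ℤ) (m k : ℕ) : ℂ :=
  ∑ j ∈ Finset.range (k + 1), W j / W k *
    ((∏ i ∈ Finset.Icc 1 m, (S j - S (c i)) / W (c i)) /
      ∏ i ∈ (Finset.range (k + 1)).erase j, (S j - S i) / W i)

section DividedDifference

variable {W S : ℤ → ℂ} {c : ℕ → ℤ}

theorem weightedDivDiff_succ_zero (m : ℕ) :
    weightedDivDiff W S c (m + 1) 0 =
      (S 0 - S (c (m + 1))) / W (c (m + 1)) * weightedDivDiff W S c m 0 := by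
  simp only [weightedDivDiff, zero_add, Finset.sum_range_one, Nat.cast_zero,
    Finset.prod_Icc_succ_top (show 1 ≤ m + 1 by omega)]
  ring

/-- The Leibniz rule for divided differences, with one factor linear. -/
theorem weightedDivDiff_succ_succ {k : ℕ} (hW : W k ≠ 0) (hW' : W (k + 1 : ℕ) ≠ 0)
    (hS : ∀ j ≤ k, S j ≠ S (k + 1 : ℕ)) (m : ℕ) :
    weightedDivDiff W S c (m + 1) (k + 1) =
      W k / W (c (m + 1)) * weightedDivDiff W S c m k +
      (S (k + 1 : ℕ) - S (c (m + 1))) / W (c (m + 1)) * weightedDivDiff W S c m (k + 1) := by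
  rw [← sub_eq_iff_eq_add]
  simp only [weightedDivDiff, Finset.prod_Icc_succ_top (show 1 ≤ m + 1 by omega)]
  rw [Finset.mul_sum, ← Finset.sum_sub_distrib, Finset.sum_range_succ, Finset.mul_sum]
  have hlast : ∀ P Q R : ℂ, P * (Q * ((S (k + 1 : ℕ) - S (c (m + 1))) / W (c (m + 1))) / R) -
      (S (k + 1 : ℕ) - S (c (m + 1))) / W (c (m + 1)) * (P * (Q / R)) = 0 := fun P Q R => by ring
  -- the difference has the factor `S j - S (k + 1)`, so that the term `j = k + 1` drops out
  rw [hlast, add_zero]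
  refine Finset.sum_congr rfl fun j hj => ?_
  have hjk : j ≤ k := Nat.lt_succ_iff.mp (Finset.mem_range.mp hj)
  have herase : (Finset.range (k + 1 + 1)).erase j =
      insert (k + 1) ((Finset.range (k + 1)).erase j) := by
    ext i
    simp only [Finset.mem_erase, Finset.mem_range, Finset.mem_insert]
    omega
  rw [herase, Finset.prod_insert (by simp)]
  have hne : S j - S (k + 1 : ℕ) ≠ 0 := sub_ne_zero.mpr (hS j hjk)
  generalize ∏ i ∈ (Finset.range (k + 1)).erase j, (S j - S i) / W i = R
  generalize ∏ i ∈ Finset.Icc 1 m, (S j - S (c i)) / W (c i) = A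
  have h1 : ∀ D : ℂ, D ≠ 0 → ∀ V : ℂ, W j / W (k + 1 : ℕ) *
      (A * ((S j - V) / W (c (m + 1))) / (D / W (k + 1 : ℕ) * R)) -
      (S (k + 1 : ℕ) - V) / W (c (m + 1)) * (W j / W (k + 1 : ℕ) * (A / (D / W (k + 1 : ℕ) * R))) =
      (S j - S (k + 1 : ℕ)) / D * (W j / W (c (m + 1)) * (A / R)) := fun D hD V => by
    rw [div_mul_eq_mul_div D, div_div_eq_mul_div, div_div_eq_mul_div]
    field_simp
    ring
  rw [h1 _ hne, div_self hne]
  field_simp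

theorem weightedDivDiff_zero_zero (hW : W 0 ≠ 0) : weightedDivDiff W S c 0 0 = 1 := by
  simp [weightedDivDiff, hW]

/-- The divided differences of a constant vanish. -/
theorem weightedDivDiff_zero_succ {k : ℕ}
    (hS : Set.InjOn (fun j : ℕ => S j) (Finset.range (k + 1 + 1))) :
    weightedDivDiff W S c 0 (k + 1) = 0 := by
  have hsum := Lagrange.coeff_eq_sum (P := (1 : Polynomial ℂ)) hS
    (by
      rw [Finset.card_range]
      exact Polynomial.degree_one_le.trans_lt (by exact_mod_cast Nat.succ_pos _))
  rw [Finset.card_range, Nat.add_sub_cancel, Polynomial.coeff_one, if_neg (by omega)] at hsum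
  have : weightedDivDiff W S c 0 (k + 1) =
      (∏ i ∈ Finset.range (k + 1 + 1), W i) / W (k + 1 : ℕ) * ∑ j ∈ Finset.range (k + 1 + 1),
        Polynomial.eval (S j) 1 / ∏ i ∈ (Finset.range (k + 1 + 1)).erase j, (S j - S i) := by
    rw [weightedDivDiff, Finset.mul_sum]
    refine Finset.sum_congr rfl fun j hj => ?_
    rw [Finset.Icc_eq_empty_of_lt Nat.zero_lt_one, Finset.prod_empty, Finset.prod_div_distrib,
      one_div_div, ← Finset.mul_prod_erase _ _ hj, Polynomial.eval_one]
    ring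
  rw [this, ← hsum, mul_zero]

end DividedDifference

/-! ### Rook numbers as divided differences -/

/-- The rook numbers are divided differences. By induction on the number of columns: both sides
satisfy the same recursion. The induction includes the vanishing for `k > m`, which the step for
`k = m` needs. -/
theorem IsGeneric.weightedDivDiff_eq {a b q p : ℂ} {n N : ℕ} (hg : IsGeneric a b q p n N)
    {h : ℕ → ℕ} (hmono : MonotoneOn h (Set.Icc 1 n)) (hN : ∀ i ∈ Finset.Icc 1 n, h i ≤ N)
    {m : ℕ} (hm : m ≤ n) : ∀ k ≤ n,
    weightedDivDiff (ellWeight a b q p) (ellNumber a b q p) (fun i => (i : ℤ) - 1 - h i) m k =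
      if k ≤ m then ellRook a b q p (ferrersBoard m h) (m - k) else 0 := by
  have hW : ∀ j : ℕ, j ≤ n → ellWeight a b q p j ≠ 0 := fun j hj =>
    hg.ellWeight_ne_zero (by omega) (by omega)
  induction m with
  | zero =>
    rintro (_ | k) hk
    · rw [weightedDivDiff_zero_zero (by simpa using hW 0 (by omega)), if_pos le_rfl]
      have hB : ferrersBoard 0 h = ∅ := by simp [ferrersBoard]
      simp [hB, ellRook, rookPlacements, placementWeight, uncancelled, Finset.filter_singleton]
    · rw [if_neg (by omega)]
      refine weightedDivDiff_zero_succ ?_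
      intro i hi j hj hij
      have hi' := Finset.mem_range.mp (Finset.mem_coe.mp hi)
      have hj' := Finset.mem_range.mp (Finset.mem_coe.mp hj)
      rcases lt_trichotomy i j with hlt | heq | hlt
      · exact absurd hij.symm (hg.ellNumber_ne hlt (by omega))
      · exact heq
      · exact absurd hij (hg.ellNumber_ne hlt (by omega))
  | succ m ih =>
    specialize ih (by omega)
    have hh : ∀ i ∈ Finset.Icc 1 m, h i ≤ h (m + 1) := fun i hi => by
      have := Finset.mem_Icc.mp hi
      exact hmono ⟨this.1, by omega⟩ ⟨by omega, hm⟩ (by omega)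
    have hH : h (m + 1) ≤ N := hN _ (Finset.mem_Icc.mpr ⟨by omega, hm⟩)
    have hc : ((m + 1 : ℕ) : ℤ) - 1 - h (m + 1) = m - h (m + 1) := by push_cast; ring
    have hA : ∀ r : ℕ, (∏ t ∈ Finset.Icc (r + 1) (h (m + 1)),
        ellCellWeight a b q p ((m + 1 : ℤ) - (t : ℤ))) * ellRook a b q p (ferrersBoard m h) r =
        ellWeight a b q p (m - r) / ellWeight a b q p (m - h (m + 1)) *
          ellRook a b q p (ferrersBoard m h) r := fun r => by
      rcases le_or_gt r (h (m + 1)) with hr | hr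
      · rw [← hg.prod_ellCellWeight (by omega) hr hH,
          show Finset.Icc (r + 1) (h (m + 1)) = Finset.Ioc r (h (m + 1)) by
            ext; simp only [Finset.mem_Icc, Finset.mem_Ioc, Nat.succ_le_iff]]
      · rw [ellRook_eq_zero_of_forall_lt a b q p hh hr, mul_zero, mul_zero]
    have hC : ∀ r : ℕ, (∑ t ∈ Finset.Icc (r + 1) (h (m + 1)), ∏ u ∈ Finset.Ioc t (h (m + 1)),
        ellCellWeight a b q p ((m + 1 : ℤ) - (u : ℤ))) * ellRook a b q p (ferrersBoard m h) r =
        (ellNumber a b q p (m - r) - ellNumber a b q p (m - h (m + 1))) /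
          ellWeight a b q p (m - h (m + 1)) * ellRook a b q p (ferrersBoard m h) r := fun r => by
      rcases le_or_gt r (h (m + 1)) with hr | hr
      · rw [hg.sum_prod_ellCellWeight (by omega) hr hH]
      · rw [ellRook_eq_zero_of_forall_lt a b q p hh hr, mul_zero, mul_zero]
    rintro (_ | k) hk
    · rw [weightedDivDiff_succ_zero, ih 0 (by omega), if_pos (by omega), if_pos (by omega),
        Nat.sub_zero, Nat.sub_zero, ellRook_succ_succ a b q p hh m, hC m,
        ellRook_eq_zero_of_lt a b q p h (Nat.lt_succ_self m), mul_zero, zero_add, hc, sub_self]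
    · rw [weightedDivDiff_succ_succ (hW k (by omega)) (hW (k + 1) hk)
        (fun j hj => (hg.ellNumber_ne (Nat.lt_succ_of_le hj) hk).symm), ih k (by omega),
        ih (k + 1) hk]
      rw [hc]
      rcases lt_trichotomy k m with hkm | rfl | hkm
      · obtain ⟨r, rfl⟩ := Nat.exists_eq_add_of_lt hkm
        rw [if_pos (by omega), if_pos (by omega), if_pos (by omega),
          show k + r + 1 + 1 - (k + 1) = r + 1 by omega, show k + r + 1 - k = r + 1 by omega,
          show k + r + 1 - (k + 1) = r by omega, ellRook_succ_succ a b q p hh r, hA, hC,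
          show ((k + r + 1 : ℕ) : ℤ) - (r + 1 : ℕ) = k by push_cast; ring,
          show ((k + r + 1 : ℕ) : ℤ) - r = (k + 1 : ℕ) by push_cast; ring]
      · rw [if_pos le_rfl, if_neg (by omega), if_pos le_rfl, Nat.sub_self, Nat.sub_self,
          ellRook_succ_zero a b q p hh, mul_zero, add_zero, hA 0, Nat.cast_zero, sub_zero]
      · rw [if_neg (by omega), if_neg (by omega), if_neg (by omega), mul_zero, mul_zero, add_zero]

end EllipticRook

theorem mainTheorem6 (a b q p : ℂ) (ha : a ≠ 0) (hb : b ≠ 0) (hq : q ≠ 0) (hp : ‖p‖ < 1)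
    (n : ℕ) (h : ℕ → ℕ) (hmono : MonotoneOn h (Set.Icc 1 n))
    (N : ℕ) (hN : ∀ i ∈ Finset.Icc 1 n, h i ≤ N)
    (hθq : ∀ m : ℤ, 1 ≤ m → m ≤ (n : ℤ) → EllipticRook.theta (q ^ m) p ≠ 0)
    (hθa : ∀ m : ℤ, -(2 * (N : ℤ)) < m → m ≤ 2 * (n : ℤ) + 1 →
      EllipticRook.theta (a * q ^ m) p ≠ 0)
    (hθb : ∀ m : ℤ, -(N : ℤ) ≤ m → m ≤ (n : ℤ) + 1 →
      EllipticRook.theta (b * q ^ m) p ≠ 0)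
    (hθab : ∀ m : ℤ, -(N : ℤ) ≤ m → m ≤ (n : ℤ) + 1 →
      EllipticRook.theta (a * q ^ m / b) p ≠ 0)
    (k : ℕ) (hk : k ≤ n) :
    EllipticRook.ellRook a b q p (EllipticRook.ferrersBoard n h) (n - k) =
      ∑ j ∈ Finset.range (k + 1),
        EllipticRook.ellWeight a b q p (j : ℤ) / EllipticRook.ellWeight a b q p (k : ℤ) *
          ((∏ i ∈ Finset.Icc 1 n,
              EllipticRook.ellNumber (a * q ^ (2 * ((i : ℤ) - 1 - (h i : ℤ))))
                (b * q ^ ((i : ℤ) - 1 - (h i : ℤ))) q p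
                ((j : ℤ) - (i : ℤ) + (h i : ℤ) + 1)) /
            (∏ i ∈ (Finset.range (k + 1)).erase j,
              EllipticRook.ellNumber (a * q ^ (2 * (i : ℤ))) (b * q ^ (i : ℤ)) q p
                ((j : ℤ) - (i : ℤ)))) := by
  have hg : EllipticRook.IsGeneric a b q p n N := ⟨ha, hb, hq, hp, hθq, hθa, hθb, hθab⟩
  have hmain := hg.weightedDivDiff_eq hmono hN le_rfl k hk
  rw [if_pos hk] at hmain
  rw [← hmain, EllipticRook.weightedDivDiff]
  refine Finset.sum_congr rfl fun j hj => ?_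
  have hjk := Finset.mem_range.mp hj
  have key : ∀ c : ℤ, -(N : ℤ) ≤ c → c ≤ n →
      (EllipticRook.ellNumber a b q p j - EllipticRook.ellNumber a b q p c) /
        EllipticRook.ellWeight a b q p c =
      EllipticRook.ellNumber (a * q ^ (2 * c)) (b * q ^ c) q p (j - c) := fun c h1 h2 => by
    rw [← hg.ellWeight_mul_ellNumber h1 h2 (by omega) (by omega),
      mul_div_cancel_left₀ _ (hg.ellWeight_ne_zero h1 h2)]
  congr 2
  · refine Finset.prod_congr rfl fun i hi => ?_
    have h1 := hN i hi
    have h2 := Finset.mem_Icc.mp hi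
    rw [key _ (by omega) (by omega)]
    congr 1
    ring
  · refine Finset.prod_congr rfl fun i hi => ?_
    have h1 := Finset.mem_range.mp (Finset.mem_of_mem_erase hi)
    exact key i (by omega) (by omega)
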